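/- Let $k\ge 2$ and let $\mathcal H=\mathcal H_{A_1}\otimes\cdots\otimes\mathcal H_{A_k}$ be a tensor product of finite-dimensional complex Hilbert spaces with fixed orthonormal bases. A state is a positive semi-definite operator on $\mathcal H$ of unit trace. For a state $\rho$ and a positive semi-definite operator $\sigma$, let $$D(\rho\|\sigma)=\operatorname{Tr}[\rho(\log_2\rho-\log_2\sigma)]\ \text{ if } \operatorname{supp}\rho\subseteq\operatorname{supp}\sigma,\qquad D(\rho\|\sigma)=+\infty\ \text{ otherwise,}$$ and for $\alpha\in(0,1)\cup(1,\infty)$ let $$\widetilde D_\alpha(\rho\|\sigma)=\frac{1}{\alpha-1}\log_2\operatorname{Tr}\Big[\big(\sigma^{\frac{1-\alpha}{2\alpha}}\rho\,\sigma^{\frac{1-\alpha}{2\alpha}}\big)^{\alpha}\Big]$$ if $\alpha<1$ or $\operatorname{supp}\rho\subseteq\operatorname{supp}\sigma$, and $\widetilde D_\alpha(\rho\|\sigma)=+\infty$ otherwise; here logarithms and negative powers of operators are taken on the support, and $\log_2 0=-\infty$ for the number $0$ (so that $\widetilde D_\alpha(\rho\|\sigma)=+\infty$ if $\alpha<1$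 and the trace vanishes). For $\boldsymbol D\in\{D,\widetilde D_\alpha\}$ and a state $\rho$ on $\mathcal H$ put $$\boldsymbol R(\rho)=\inf\Big\{\boldsymbol D(\rho\|\sigma)+\log_2\Big(\sum_m r_m\|T_m(\omega_m)\|_1\Big)\ :\ \sigma=\sum_m r_m\omega_m\Big\},$$ where $m$ ranges over the unordered bipartitions of the $k$ parties into two nonempty groups, $(r_m)_m$ ranges over the probability distributions, each $\omega_m$ ranges over the states on $\mathcal H$, $T_m$ is the partial transpose with respect to one of the two groups of $m$ (the trace norm does not depend on which), and $\|X\|_1=\operatorname{Tr}\sqrt{X^\dagger X}$. For $\boldsymbol D=D$ this defines the genuine multipartite Rains entanglement (GMRE) $R(\rho)$, and for $\boldsymbol D=\widetilde D_\alpha$ the sandwiched Rényi–Rains entanglement $\widetilde R_\alpha(\rho)$. Then, for every state $\rho$ on $\mathcal H$, $$\lim_{\alpha\to1}\widetilde R_\alpha(\rho)=R(\rho),$$ the limit being two-sided. -/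

import Mathlib

noncomputable section

namespace MultipartiteRains

open scoped ComplexOrder

section Operators

variable {n : Type*} [Fintype n] [DecidableEq n]

/-- A quantum state: a positive semi-definite operator with unit trace. -/
def IsState (ρ : Matrix n n ℂ) : Prop :=
  ρ.PosSemidef ∧ ρ.trace = 1

/-- The support of an operator: the orthogonal complement of its kernel. -/
def supp (A : Matrix n n ℂ) : Submodule ℂ (EuclideanSpace ℂ n) :=
  (LinearMap.ker (Matrix.toEuclideanLin A))ᗮ

/-- The real power `A ^ p` of a positive semi-definite operator, through the spectral theorem.
Since `(0 : ℝ) ^ p = 0` for `p ≠ 0`, for `p < 0` the inverse is taken on the support. -/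
def opPow (A : Matrix n n ℂ) (p : ℝ) : Matrix n n ℂ :=
  cfc (fun x : ℝ => x ^ p) A

/-- The base-two logarithm of a positive semi-definite operator, taken on its support
(`Real.logb 2 0 = 0`). -/
def opLog (A : Matrix n n ℂ) : Matrix n n ℂ :=
  cfc (fun x : ℝ => Real.logb 2 x) A

/-- The trace norm `Tr |A|` with `|A| = √(Aᴴ A)`. -/
def traceNorm (A : Matrix n n ℂ) : ℝ :=
  (cfc Real.sqrt (A.conjTranspose * A)).trace.re

/-- The base-two logarithm of a nonnegative real, with `log₂ 0 = -∞`. -/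
def elog (x : ℝ) : EReal :=
  if x ≤ 0 then ⊥ else ((Real.logb 2 x : ℝ) : EReal)

open Classical in
/-- The quantum (Umegaki) relative entropy `D(ρ‖σ)`. -/
def relEntropy (ρ σ : Matrix n n ℂ) : EReal :=
  if supp ρ ≤ supp σ then (((ρ * (opLog ρ - opLog σ)).trace.re : ℝ) : EReal) else ⊤

/-- `Tr[(σ^((1-α)/(2α)) ρ σ^((1-α)/(2α)))^α]`. -/
def sandwichedQ (α : ℝ) (ρ σ : Matrix n n ℂ) : ℝ :=
  (opPow (opPow σ ((1 - α) / (2 * α)) * ρ * opPow σ ((1 - α) / (2 * α))) α).trace.re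

open Classical in
/-- The sandwiched Rényi relative entropy of order `α ∈ (0,1) ∪ (1,∞)`. For `α < 1` and `ρ`, `σ`
with orthogonal supports the trace vanishes and the value is `(α - 1)⁻¹ * (-∞) = +∞`. -/
def sandwichedRelEntropy (α : ℝ) (ρ σ : Matrix n n ℂ) : EReal :=
  if α < 1 ∨ (1 < α ∧ supp ρ ≤ supp σ) then
    ((1 / (α - 1) : ℝ) : EReal) * elog (sandwichedQ α ρ σ)
  else ⊤

end Operators

section Multipartite

variable {k : ℕ} {d : Fin k → ℕ}

/-- Operators on `ℂ^(d 0) ⊗ ⋯ ⊗ ℂ^(d (k-1))`, as matrices in the product basis. -/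
abbrev Op (d : Fin k → ℕ) : Type :=
  Matrix (∀ i, Fin (d i)) (∀ i, Fin (d i)) ℂ

/-- The unordered bipartitions `{S, Sᶜ}` of `k` parties into two nonempty groups, each represented
by the group `S` that does not contain the first party. -/
abbrev Bipartition (k : ℕ) : Type :=
  {S : Finset (Fin k) // S.Nonempty ∧ ∀ i ∈ S, (i : ℕ) ≠ 0}

/-- The partial transpose on the parties in `S`, in the product basis. -/
def partialTranspose (S : Finset (Fin k)) (X : Op d) : Op d :=
  Matrix.of fun a b =>
    X (fun i => if i ∈ S then b i else a i) (fun i => if i ∈ S then a i else b i)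

/-- The multipartite `D`-Rains entanglement: the infimum of
`D(ρ‖σ) + log₂ (∑ₘ rₘ ‖Tₘ(ωₘ)‖₁)` over all `σ = ∑ₘ rₘ ωₘ` with `r` a probability distribution on the
bipartitions and `ωₘ` states. -/
def rainsEntanglement (D : Op d → Op d → EReal) (ρ : Op d) : EReal :=
  sInf {x : EReal | ∃ (σ : Op d) (r : Bipartition k → ℝ) (ω : Bipartition k → Op d),
    IsState σ ∧ (∀ m, 0 ≤ r m) ∧ ∑ m, r m = 1 ∧ (∀ m, IsState (ω m)) ∧
    σ = ∑ m, (r m : ℂ) • ω m ∧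
    x = D ρ σ +
      ((Real.logb 2 (∑ m, r m * traceNorm (partialTranspose m.1 (ω m))) : ℝ) : EReal)}

/-- The genuine multipartite Rains entanglement (GMRE). -/
def gmre (ρ : Op d) : EReal :=
  rainsEntanglement relEntropy ρ

/-- The multipartite sandwiched Rényi–Rains entanglement of order `α`. -/
def sandwichedRains (α : ℝ) (ρ : Op d) : EReal :=
  rainsEntanglement (sandwichedRelEntropy α) ρ

end Multipartite

end MultipartiteRains

end

noncomputable section

namespace MultipartiteRains

open scoped ComplexOrder
open Matrix Filter Topology

/-! ### Traces of functional calculi as double sums over eigenvalues. -/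

section FunctionalCalculus

variable {n : Type*} [Fintype n] [DecidableEq n]

/-! The two halves of the limit are proved separately, each for both signs of `α - 1` at once and
without monotonicity in `α`. Everything is phrased through the quotient `(Q - 1) / (α - 1)`, where
`Q` is the trace in the sandwiched divergence: a bound on it passes to `log Q / (α - 1)` with the
right direction on either side of `1`.

Upper half (`eventually_sandwichedRains_lt`): fix a decomposition nearly optimal for the GMRE. For
this `σ` the quotient has an upper bound converging to `D(ρ‖σ)` (`exists_tendsto_upper`), from a
second-order estimate of `x ^ α` at `α = 1`.

Lower half (`eventually_lt_sandwichedRains`): the optimal `σ` may move with `α` and approach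
operators whose support misses part of that of `ρ`, so a bound locally uniform in `σ` is needed. The
tangent inequality for `x ^ α` at `ρ` replaces `Q` by `Tr[ρ^α σ^((1-α)/α)]` (`tangent_quotient_le`).
Truncating the logarithm at `log ε` then gives a bound jointly continuous in `α` and `σ`
(`lowerQuotient_le`, `tendsto_lowerQuotient`). A suitable `ε` recovers any number below `D(ρ‖σ)`,
even when it is infinite (`exists_lt_truncLog_of_lt_relEntropy`). Compactness of the set of
decompositions makes the local bounds uniform. -/

/-- The squared moduli of the inner products between the eigenvectors of two Hermitian matrices. -/
def overlap {A B : Matrix n n ℂ} (hA : A.IsHermitian) (hB : B.IsHermitian) (i j : n) : ℝ :=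
  ‖((hA.eigenvectorUnitary : Matrix n n ℂ)ᴴ * (hB.eigenvectorUnitary : Matrix n n ℂ)) i j‖ ^ 2

lemma overlap_nonneg {A B : Matrix n n ℂ} (hA : A.IsHermitian) (hB : B.IsHermitian) (i j : n) :
    0 ≤ overlap hA hB i j := by
  unfold overlap; positivity

lemma cfc_eq_conj {A : Matrix n n ℂ} (hA : A.IsHermitian) (f : ℝ → ℝ) :
    cfc f A = (hA.eigenvectorUnitary : Matrix n n ℂ) *
      diagonal (fun i => (f (hA.eigenvalues i) : ℂ)) *
        (hA.eigenvectorUnitary : Matrix n n ℂ)ᴴ := by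
  rw [hA.cfc_eq, Matrix.IsHermitian.cfc, Unitary.conjStarAlgAut_apply]
  rfl

/-- In the two eigenbases the trace is a sum with nonnegative weights, so trace inequalities reduce
to scalar ones for pairs of eigenvalues. -/
lemma trace_cfc_mul_cfc_complex {A B : Matrix n n ℂ} (hA : A.IsHermitian) (hB : B.IsHermitian)
    (f g : ℝ → ℝ) :
    (cfc f A * cfc g B).trace =
      ((∑ i, ∑ j, overlap hA hB i j * (f (hA.eigenvalues i) * g (hB.eigenvalues j)) : ℝ) : ℂ) := by
  rw [cfc_eq_conj hA, cfc_eq_conj hB]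
  set U := (hA.eigenvectorUnitary : Matrix n n ℂ)
  set V := (hB.eigenvectorUnitary : Matrix n n ℂ)
  set D := diagonal (fun i => (f (hA.eigenvalues i) : ℂ))
  set E := diagonal (fun i => (g (hB.eigenvalues i) : ℂ))
  have h1 : (U * D * Uᴴ * (V * E * Vᴴ)).trace = (D * (Uᴴ * V) * (E * (Uᴴ * V)ᴴ)).trace := by
    rw [conjTranspose_mul, conjTranspose_conjTranspose]
    calc _ = (U * (D * (Uᴴ * V) * (E * Vᴴ))).trace := by simp only [Matrix.mul_assoc]
      _ = ((D * (Uᴴ * V) * (E * Vᴴ)) * U).trace := Matrix.trace_mul_comm _ _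
      _ = _ := by simp only [Matrix.mul_assoc]
  rw [h1]
  simp only [Matrix.trace, Matrix.diag_apply, Matrix.mul_apply (M := D * (Uᴴ * V)), D, E,
    Matrix.diagonal_mul, Matrix.conjTranspose_apply]
  push_cast
  refine Finset.sum_congr rfl fun i _ => Finset.sum_congr rfl fun j _ => ?_
  have h2 : ((overlap hA hB i j : ℝ) : ℂ) = (Uᴴ * V) i j * star ((Uᴴ * V) i j) := by
    rw [overlap, RCLike.star_def, Complex.mul_conj, Complex.normSq_eq_norm_sq]
  rw [h2]; ring

lemma trace_cfc_mul_cfc {A B : Matrix n n ℂ} (hA : A.IsHermitian) (hB : B.IsHermitian)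
    (f g : ℝ → ℝ) :
    (cfc f A * cfc g B).trace.re =
      ∑ i, ∑ j, overlap hA hB i j * (f (hA.eigenvalues i) * g (hB.eigenvalues j)) := by
  rw [trace_cfc_mul_cfc_complex hA hB, Complex.ofReal_re]

lemma cfc_id_eq {A : Matrix n n ℂ} (hA : A.IsHermitian) : cfc (fun x : ℝ => x) A = A :=
  cfc_id' ℝ A hA

lemma cfc_one_eq {A : Matrix n n ℂ} (hA : A.IsHermitian) : cfc (fun _ : ℝ => (1 : ℝ)) A = 1 :=
  cfc_const_one ℝ A hA

lemma continuousOn_spectrum (A : Matrix n n ℂ) (f : ℝ → ℝ) : ContinuousOn f (spectrum ℝ A) :=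
  A.finite_real_spectrum.continuousOn f

lemma cfc_mul_eq {A : Matrix n n ℂ} (f g : ℝ → ℝ) :
    cfc f A * cfc g A = cfc (fun x => f x * g x) A :=
  (cfc_mul f g A (continuousOn_spectrum A f) (continuousOn_spectrum A g)).symm

lemma isHermitian_cfc (f : ℝ → ℝ) (A : Matrix n n ℂ) : (cfc f A).IsHermitian :=
  cfc_predicate f A

lemma spectrum_nonneg_of_posSemidef {A : Matrix n n ℂ} (hA : A.PosSemidef) :
    ∀ x ∈ spectrum ℝ A, 0 ≤ x := by
  intro x hx
  rw [hA.isHermitian.spectrum_real_eq_range_eigenvalues] at hx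
  obtain ⟨i, rfl⟩ := hx
  exact hA.eigenvalues_nonneg i

lemma cfc_congr_of_posSemidef {A : Matrix n n ℂ} (hA : A.PosSemidef) {f g : ℝ → ℝ}
    (h : ∀ x, 0 ≤ x → f x = g x) : cfc f A = cfc g A :=
  cfc_congr fun x hx => h x (spectrum_nonneg_of_posSemidef hA x hx)

lemma trace_cfc {A : Matrix n n ℂ} (hA : A.IsHermitian) (f : ℝ → ℝ) :
    (cfc f A).trace = ((∑ i, f (hA.eigenvalues i) : ℝ) : ℂ) := by
  rw [cfc_eq_conj hA, Matrix.trace_mul_cycle, ← Matrix.star_eq_conjTranspose,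
    Unitary.coe_star_mul_self, Matrix.one_mul, Matrix.trace_diagonal]
  push_cast; rfl

lemma trace_cfc_re {A : Matrix n n ℂ} (hA : A.IsHermitian) (f : ℝ → ℝ) :
    (cfc f A).trace.re = ∑ i, f (hA.eigenvalues i) := by
  rw [trace_cfc hA, Complex.ofReal_re]

/-- `Aᴴ A` and `A Aᴴ` have the same characteristic polynomial, hence the same eigenvalues with
multiplicity. -/
lemma trace_cfc_conjTranspose_mul_self (A : Matrix n n ℂ) (f : ℝ → ℝ) :
    (cfc f (Aᴴ * A)).trace.re = (cfc f (A * Aᴴ)).trace.re := by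
  have h1 := isHermitian_conjTranspose_mul_self A
  have h2 := isHermitian_mul_conjTranspose_self A
  rw [trace_cfc_re h1, trace_cfc_re h2]
  have key : Multiset.map (RCLike.ofReal ∘ h1.eigenvalues) Finset.univ.val =
      (Multiset.map (RCLike.ofReal ∘ h2.eigenvalues) Finset.univ.val : Multiset ℂ) := by
    rw [← h1.roots_charpoly_eq_eigenvalues, ← h2.roots_charpoly_eq_eigenvalues,
      Matrix.charpoly_mul_comm]
  have := congrArg (fun s => (Multiset.map (fun z : ℂ => f z.re) s).sum) key
  simpa [Multiset.map_map, Function.comp_def] using this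

open scoped Matrix.Norms.L2Operator in
lemma continuousOn_cfc_isHermitian {f : ℝ → ℝ} (hf : Continuous f) :
    ContinuousOn (fun A : Matrix n n ℂ => cfc f A) {A | A.IsHermitian} :=
  ContinuousOn.cfc_of_mem_nhdsSet (s := Set.univ) f (by simp) continuousOn_id
    (fun _ hx => hx) hf.continuousOn

end FunctionalCalculus

/-! ### Inclusion of supports in terms of eigenvalues. -/

section Support

variable {n : Type*} [Fintype n] [DecidableEq n]

/-- The orthogonal projection onto the kernel of a Hermitian matrix. -/
def kerProj (A : Matrix n n ℂ) : Matrix n n ℂ :=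
  cfc (fun x : ℝ => if x = 0 then 1 else 0) A

lemma mul_kerProj {A : Matrix n n ℂ} (hA : A.IsHermitian) : A * kerProj A = 0 := by
  nth_rewrite 1 [← cfc_id_eq hA]
  rw [kerProj, cfc_mul_eq]
  have : (fun x : ℝ => x * if x = 0 then (1 : ℝ) else 0) = fun _ => 0 := by
    funext x; split_ifs with h <;> simp [h]
  rw [this, cfc_const_zero]

lemma kerProj_mulVec {A : Matrix n n ℂ} (hA : A.IsHermitian) {v : n → ℂ} (hv : A *ᵥ v = 0) :
    kerProj A *ᵥ v = v := by
  -- `x⁻¹` acts as the pseudo-inverse, since `0⁻¹ = 0`.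
  have h : kerProj A + cfc (fun x : ℝ => x⁻¹) A * A = 1 := by
    nth_rewrite 3 [← cfc_id_eq hA]
    rw [kerProj, cfc_mul_eq, ← cfc_add (a := A) (hf := continuousOn_spectrum _ _)
      (hg := continuousOn_spectrum _ _), ← cfc_one_eq hA]
    congr 1; funext x
    by_cases hx : x = 0 <;> simp [hx]
  have := congrArg (· *ᵥ v) h
  simpa [Matrix.add_mulVec, ← Matrix.mulVec_mulVec, hv] using this

lemma supp_le_iff {A B : Matrix n n ℂ} :
    supp A ≤ supp B ↔ ∀ v : n → ℂ, B *ᵥ v = 0 → A *ᵥ v = 0 := by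
  have h : ∀ (C : Matrix n n ℂ) (v : EuclideanSpace ℂ n),
      v ∈ LinearMap.ker (Matrix.toEuclideanLin C) ↔ C *ᵥ (WithLp.ofLp v) = 0 := by
    intro C v
    rw [LinearMap.mem_ker, ← WithLp.ofLp_injective 2 |>.eq_iff]
    rfl
  rw [supp, supp, Submodule.orthogonal_le_orthogonal_iff]
  constructor
  · intro H v hv
    exact (h A (WithLp.toLp 2 v)).1 (H ((h B (WithLp.toLp 2 v)).2 hv))
  · intro H v hv
    exact (h A v).2 (H _ ((h B v).1 hv))

lemma supp_le_iff_mul_kerProj {A B : Matrix n n ℂ} (hB : B.IsHermitian) :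
    supp A ≤ supp B ↔ A * kerProj B = 0 := by
  rw [supp_le_iff]
  constructor
  · intro H
    refine Matrix.ext_of_mulVec_single fun i => ?_
    rw [← Matrix.mulVec_mulVec, H, Matrix.zero_mulVec]
    rw [Matrix.mulVec_mulVec, mul_kerProj hB, Matrix.zero_mulVec]
  · intro H v hv
    rw [← kerProj_mulVec hB hv, Matrix.mulVec_mulVec, H, Matrix.zero_mulVec]

lemma cfc_sqrt_mul_self {A : Matrix n n ℂ} (hA : A.PosSemidef) :
    cfc Real.sqrt A * cfc Real.sqrt A = A := by
  rw [cfc_mul_eq]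
  nth_rewrite 2 [← cfc_id_eq hA.isHermitian]
  exact cfc_congr_of_posSemidef hA fun x hx => Real.mul_self_sqrt hx

/-- With `S = √A` and `P` the kernel projection of `B`, the trace is that of `(S P)ᴴ (S P)`, which
vanishes only if `S P = 0`. -/
lemma supp_le_iff_trace {A B : Matrix n n ℂ} (hA : A.PosSemidef) (hB : B.IsHermitian) :
    supp A ≤ supp B ↔ (A * kerProj B).trace.re = 0 := by
  rw [supp_le_iff_mul_kerProj hB]
  refine ⟨fun h => by simp [h], fun h => ?_⟩
  set S := cfc Real.sqrt A with hS
  have hSh : Sᴴ = S := isHermitian_cfc _ _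
  have hPh : (kerProj B)ᴴ = kerProj B := isHermitian_cfc _ _
  have hPP : kerProj B * kerProj B = kerProj B := by
    rw [kerProj, cfc_mul_eq]; congr 1; funext x; split_ifs <;> simp
  have hz : (A * kerProj B).trace = 0 := by
    refine Complex.ext h ?_
    nth_rewrite 1 [← cfc_id_eq hA.isHermitian]
    rw [kerProj, trace_cfc_mul_cfc_complex hA.isHermitian hB, Complex.ofReal_im]; rfl
  have h3 : ((S * kerProj B)ᴴ * (S * kerProj B)).trace = 0 := by
    rw [Matrix.conjTranspose_mul, hSh, hPh]
    calc _ = (kerProj B * ((S * S) * kerProj B)).trace := by simp only [Matrix.mul_assoc]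
      _ = ((S * S) * (kerProj B * kerProj B)).trace := by
          rw [Matrix.trace_mul_comm, Matrix.mul_assoc]
      _ = 0 := by rw [hPP, cfc_sqrt_mul_self hA, hz]
  have h4 : S * kerProj B = 0 := Matrix.trace_conjTranspose_mul_self_eq_zero_iff.1 h3
  rw [← cfc_sqrt_mul_self hA, Matrix.mul_assoc, ← hS, h4, Matrix.mul_zero]

/-- The trace against the kernel projection is a sum of nonnegative terms. In this form the zero
eigenvalues of `B` drop out of later sums, whatever value is assigned to the power or logarithm at
`0`. -/
lemma supp_le_iff_overlap {A B : Matrix n n ℂ} (hA : A.PosSemidef) (hB : B.IsHermitian) :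
    supp A ≤ supp B ↔ ∀ i j, hB.eigenvalues j = 0 →
      overlap hA.isHermitian hB i j * hA.isHermitian.eigenvalues i = 0 := by
  rw [supp_le_iff_trace hA hB]
  nth_rewrite 1 [← cfc_id_eq hA.isHermitian]
  rw [kerProj, trace_cfc_mul_cfc hA.isHermitian hB, Finset.sum_eq_zero_iff_of_nonneg]
  · refine ⟨fun h i j hj => ?_, fun h i _ => Finset.sum_eq_zero fun j _ => ?_⟩
    · have := h i (Finset.mem_univ i)
      rw [Finset.sum_eq_zero_iff_of_nonneg] at this
      · simpa [hj] using this j (Finset.mem_univ j)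
      · intro j _
        refine mul_nonneg (overlap_nonneg _ _ _ _) (mul_nonneg (hA.eigenvalues_nonneg i) ?_)
        split_ifs <;> simp
    · by_cases hj : hB.eigenvalues j = 0
      · simpa [hj] using h i j hj
      · simp [hj]
  · intro i _
    refine Finset.sum_nonneg fun j _ => mul_nonneg (overlap_nonneg _ _ _ _)
      (mul_nonneg (hA.eigenvalues_nonneg i) ?_)
    split_ifs <;> simp

end Support

/-! ### Scalar estimates near `α = 1`. -/

section Scalar

lemma exp_le_one_add_add_sq_of_nonpos {y : ℝ} (hy : y ≤ 0) : Real.exp y ≤ 1 + y + y ^ 2 := by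
  have h1 : 1 - y ≤ Real.exp (-y) := by linarith [Real.add_one_le_exp (-y)]
  have h2 : Real.exp y * Real.exp (-y) = 1 := by rw [← Real.exp_add]; simp
  have h3 : Real.exp y * (1 - y) ≤ 1 := by
    exact (mul_le_mul_of_nonneg_left h1 (Real.exp_pos y).le).trans h2.le
  have h4 : (1 + y + y ^ 2) * (1 - y) = 1 + y ^ 2 * (-y) := by ring
  have h5 : 0 ≤ y ^ 2 * (-y) := mul_nonneg (sq_nonneg y) (by linarith)
  exact le_of_mul_le_mul_right (by linarith) (by linarith : 0 < 1 - y)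

lemma exp_le_one_add_add_sq_mul_exp {y : ℝ} (hy : 0 ≤ y) :
    Real.exp y ≤ 1 + y + y ^ 2 * Real.exp y := by
  have h1 : 1 - y ≤ Real.exp (-y) := by linarith [Real.add_one_le_exp (-y)]
  have h2 : Real.exp y * Real.exp (-y) = 1 := by rw [← Real.exp_add]; simp
  have h3 : Real.exp y * ((1 - y) * (1 + y)) ≤ 1 + y := by
    calc _ ≤ Real.exp y * (Real.exp (-y) * (1 + y)) := by gcongr
      _ = 1 + y := by rw [← mul_assoc, h2, one_mul]
  linarith [h3, show Real.exp y * ((1 - y) * (1 + y)) = Real.exp y - y ^ 2 * Real.exp y by ring]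

/-- A continuous function that equals `x * (log x) ^ 2 * max 1 x` for `0 ≤ x`. -/
def logSqWeight (x : ℝ) : ℝ := 4 * (√x * Real.log √x) ^ 2 * max 1 x

/-- Writing the weight through `√x * log √x` reduces continuity at `0` to that of `x * log x`. -/
lemma continuous_logSqWeight : Continuous logSqWeight := by
  have h : Continuous fun x : ℝ => √x * Real.log √x :=
    Real.continuous_mul_log.comp Real.continuous_sqrt
  unfold logSqWeight
  fun_prop

lemma logSqWeight_eq {x : ℝ} (hx : 0 ≤ x) :
    logSqWeight x = x * Real.log x ^ 2 * max 1 x := by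
  rw [logSqWeight, Real.log_sqrt hx, mul_pow, Real.sq_sqrt hx]; ring

/-- A second-order upper estimate for the difference quotient of `α ↦ x ^ α` at `α = 1`. -/
lemma rpow_sub_self_div_le {x α : ℝ} (hx : 0 ≤ x) (h0 : 0 < α) (h2 : α ≤ 2) (h1 : α ≠ 1) :
    (x ^ α - x) / (α - 1) ≤ x * Real.log x + |α - 1| * logSqWeight x := by
  rcases hx.eq_or_lt with rfl | hx
  · simp [Real.zero_rpow h0.ne', logSqWeight]
  set y := (α - 1) * Real.log x with hy
  have hxa : x ^ α = x * Real.exp y := by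
    rw [hy, mul_comm (α - 1), ← Real.rpow_def_of_pos hx,
      ← Real.rpow_one_add' hx.le (by simpa using h0.ne')]
    simp
  rw [logSqWeight_eq hx.le]
  rcases lt_or_gt_of_ne h1 with h | h
  -- Here `1 + y ≤ exp y` suffices: division by `α - 1 < 0` reverses it, and the error term only
  -- helps.
  · have ht : α - 1 < 0 := by linarith
    rw [div_le_iff_of_neg ht]
    have h3 : x * (1 + y) ≤ x * Real.exp y :=
      mul_le_mul_of_nonneg_left (by linarith [Real.add_one_le_exp y]) hx.le
    have h4 : |α - 1| * (x * Real.log x ^ 2 * max 1 x) * (α - 1) ≤ 0 :=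
      mul_nonpos_of_nonneg_of_nonpos (by positivity) ht.le
    rw [hxa]
    nlinarith
  · have ht : 0 < α - 1 := by linarith
    rw [div_le_iff₀ ht, abs_of_pos ht, hxa]
    -- For `y ≥ 0` the factor `exp y` in the remainder is at most `x`, because `α - 1 ≤ 1`; hence
    -- the weight `max 1 x`.
    have h3 : Real.exp y ≤ 1 + y + y ^ 2 * max 1 x := by
      rcases le_total y 0 with h | h
      · calc _ ≤ 1 + y + y ^ 2 * 1 := by linarith [exp_le_one_add_add_sq_of_nonpos h]
          _ ≤ _ := by gcongr; exact le_max_left _ _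
      · refine (exp_le_one_add_add_sq_mul_exp h).trans ?_
        have h5 : 0 ≤ Real.log x := by
          by_contra hneg
          push Not at hneg
          have : y < 0 := mul_neg_of_pos_of_neg ht hneg
          linarith
        have h6 : Real.exp y ≤ x := by
          rw [← Real.le_log_iff_exp_le hx, hy]
          nlinarith
        gcongr
        exact h6.trans (le_max_right _ _)
    have h4 := mul_le_mul_of_nonneg_left h3 hx.le
    calc _ ≤ x * (1 + y + y ^ 2 * max 1 x) - x := by linarith
      _ = _ := by rw [hy]; ring

/-- The slope of `log` at `1`, extended continuously by `dslope`, also covers the points where `u`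
vanishes. -/
lemma tendsto_log_one_add_mul_div {ι : Type*} {l : Filter ι} {t u : ι → ℝ} {c : ℝ}
    (ht : Tendsto t l (𝓝 0)) (ht0 : ∀ᶠ i in l, t i ≠ 0) (hu : Tendsto u l (𝓝 c)) :
    Tendsto (fun i => Real.log (1 + t i * u i) / t i) l (𝓝 c) := by
  have hd : ContinuousAt (dslope Real.log 1) 1 :=
    continuousAt_dslope_same.2 (Real.differentiableAt_log one_ne_zero)
  have h1 : Tendsto (fun i => 1 + t i * u i) l (𝓝 1) := by
    simpa using (ht.mul hu).const_add 1
  have h2 := (hd.tendsto.comp h1).mul hu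
  rw [dslope_same, Real.deriv_log, inv_one, one_mul] at h2
  refine h2.congr' ?_
  filter_upwards [ht0] with i hi
  have := sub_smul_dslope Real.log 1 (1 + t i * u i)
  simp only [add_sub_cancel_left, smul_eq_mul, Real.log_one, sub_zero] at this
  rw [Function.comp_apply, ← this]
  field_simp

end Scalar

/-! ### From the difference quotient of the trace to the divergence. -/

section Transfer

variable {n : Type*} [Fintype n] [DecidableEq n]

lemma sandwichedRelEntropy_le {α u : ℝ} {ρ σ : Matrix n n ℂ} (h1 : α ≠ 1)
    (hs : supp ρ ≤ supp σ) (hu : (sandwichedQ α ρ σ - 1) / (α - 1) ≤ u)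
    (hpos : 0 < 1 + (α - 1) * u) :
    sandwichedRelEntropy α ρ σ ≤
      ((Real.log (1 + (α - 1) * u) / (α - 1) / Real.log 2 : ℝ) : EReal) := by
  have hl2 : 0 < Real.log 2 := Real.log_pos one_lt_two
  rcases lt_or_gt_of_ne h1 with h | h
  · have ht : α - 1 < 0 := by linarith
    rw [div_le_iff_of_neg ht] at hu
    have hQ : 1 + (α - 1) * u ≤ sandwichedQ α ρ σ := by linarith
    have hQ0 := hpos.trans_le hQ
    rw [sandwichedRelEntropy, if_pos (Or.inl h), elog, if_neg hQ0.not_ge, ← EReal.coe_mul,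
      EReal.coe_le_coe_iff, Real.logb, one_div_mul_eq_div, div_right_comm]
    have := Real.log_le_log hpos hQ
    exact (div_le_div_iff_of_pos_right hl2).2 (div_le_div_of_nonpos_of_le ht.le this)
  · have ht : 0 < α - 1 := by linarith
    rw [div_le_iff₀ ht] at hu
    have hQ : sandwichedQ α ρ σ ≤ 1 + (α - 1) * u := by linarith
    rw [sandwichedRelEntropy, if_pos (Or.inr ⟨h, hs⟩), elog]
    split_ifs with hQ0
    · rw [EReal.coe_mul_bot_of_pos (by positivity)]; exact bot_le
    · push Not at hQ0
      rw [← EReal.coe_mul, EReal.coe_le_coe_iff, Real.logb, one_div_mul_eq_div, div_right_comm]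
      have := Real.log_le_log hQ0 hQ
      gcongr

/-- The support condition is asked for only when `1 < α`, as its failure there makes the divergence
infinite. For `α < 1` a vanishing trace also gives `⊤`. -/
lemma le_sandwichedRelEntropy {α u : ℝ} {ρ σ : Matrix n n ℂ} (h1 : α ≠ 1)
    (hu : (1 < α → supp ρ ≤ supp σ) → u ≤ (sandwichedQ α ρ σ - 1) / (α - 1))
    (hpos : 0 < 1 + (α - 1) * u) :
    ((Real.log (1 + (α - 1) * u) / (α - 1) / Real.log 2 : ℝ) : EReal) ≤
      sandwichedRelEntropy α ρ σ := by
  have hl2 : 0 < Real.log 2 := Real.log_pos one_lt_two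
  rcases lt_or_gt_of_ne h1 with h | h
  · have ht : α - 1 < 0 := by linarith
    replace hu := hu fun h' => absurd h' h.not_gt
    rw [le_div_iff_of_neg ht] at hu
    have hQ : sandwichedQ α ρ σ ≤ 1 + (α - 1) * u := by linarith
    rw [sandwichedRelEntropy, if_pos (Or.inl h), elog]
    split_ifs with hQ0
    · rw [EReal.coe_mul_bot_of_neg (one_div_neg.2 ht)]; exact le_top
    · push Not at hQ0
      rw [← EReal.coe_mul, EReal.coe_le_coe_iff, Real.logb, one_div_mul_eq_div, div_right_comm _ (Real.log 2)]
      have := Real.log_le_log hQ0 hQ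
      exact (div_le_div_iff_of_pos_right hl2).2 (div_le_div_of_nonpos_of_le ht.le this)
  · have ht : 0 < α - 1 := by linarith
    by_cases hs : supp ρ ≤ supp σ
    · replace hu := hu fun _ => hs
      rw [le_div_iff₀ ht] at hu
      have hQ : 1 + (α - 1) * u ≤ sandwichedQ α ρ σ := by linarith
      have hQ0 := hpos.trans_le hQ
      rw [sandwichedRelEntropy, if_pos (Or.inr ⟨h, hs⟩), elog, if_neg hQ0.not_ge,
        ← EReal.coe_mul, EReal.coe_le_coe_iff, Real.logb, one_div_mul_eq_div, div_right_comm _ (Real.log 2)]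
      have := Real.log_le_log hpos hQ
      gcongr
    · rw [sandwichedRelEntropy, if_neg]
      · exact le_top
      · rintro (h' | h')
        · exact h'.not_gt h
        · exact hs h'.2

end Transfer

/-! ### Upper bound for a fixed `σ`. -/

section PointwiseUpperBound

variable {n : Type*} [Fintype n] [DecidableEq n]

/-- The operator inside the trace of the sandwiched Rényi relative entropy. -/
def sandwich (α : ℝ) (ρ σ : Matrix n n ℂ) : Matrix n n ℂ :=
  opPow σ ((1 - α) / (2 * α)) * ρ * opPow σ ((1 - α) / (2 * α))

lemma sandwichedQ_eq (α : ℝ) (ρ σ : Matrix n n ℂ) :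
    sandwichedQ α ρ σ = (cfc (fun x : ℝ => x ^ α) (sandwich α ρ σ)).trace.re := rfl

lemma posSemidef_sandwich (α : ℝ) {ρ : Matrix n n ℂ} (hρ : ρ.PosSemidef) (σ : Matrix n n ℂ) :
    (sandwich α ρ σ).PosSemidef := by
  have h : (opPow σ ((1 - α) / (2 * α)))ᴴ = opPow σ ((1 - α) / (2 * α)) := isHermitian_cfc _ _
  have := hρ.conjTranspose_mul_mul_same (opPow σ ((1 - α) / (2 * α)))
  rwa [h] at this

lemma opPow_mul_self {σ : Matrix n n ℂ} (hσ : σ.PosSemidef) {α : ℝ} (h0 : α ≠ 0) (h1 : α ≠ 1) :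
    opPow σ ((1 - α) / (2 * α)) * opPow σ ((1 - α) / (2 * α)) = opPow σ ((1 - α) / α) := by
  rw [opPow, cfc_mul_eq]
  refine cfc_congr_of_posSemidef hσ fun x hx => ?_
  have h : (1 - α) / (2 * α) + (1 - α) / (2 * α) = (1 - α) / α := by field_simp; ring
  rw [← Real.rpow_add' hx, h]
  rw [h]
  exact div_ne_zero (sub_ne_zero.2 h1.symm) h0

lemma trace_sandwich {ρ σ : Matrix n n ℂ} (hσ : σ.PosSemidef) {α : ℝ} (h0 : α ≠ 0)
    (h1 : α ≠ 1) : (sandwich α ρ σ).trace = (ρ * opPow σ ((1 - α) / α)).trace := by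
  rw [sandwich, Matrix.mul_assoc, Matrix.trace_mul_comm, Matrix.mul_assoc, opPow_mul_self hσ h0 h1]

lemma tendsto_cfc_of_eigenvalues {ι : Type*} {l : Filter ι} {A : Matrix n n ℂ}
    (hA : A.IsHermitian) {F : ι → ℝ → ℝ} {f : ℝ → ℝ}
    (h : ∀ i, Tendsto (fun t => F t (hA.eigenvalues i)) l (𝓝 (f (hA.eigenvalues i)))) :
    Tendsto (fun t => cfc (F t) A) l (𝓝 (cfc f A)) := by
  simp only [cfc_eq_conj hA]
  refine Tendsto.mul_const _ (Tendsto.const_mul _ ?_)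
  refine ((continuous_id.matrix_diagonal).tendsto _).comp (tendsto_pi_nhds.2 fun i => ?_)
  exact (Complex.continuous_ofReal.tendsto _).comp (h i)

/-- The exponent must avoid `0`: since `0 ^ 0 = 1`, the limit would otherwise fail to be the support
projection. -/
lemma tendsto_opPow_zero {ι : Type*} {l : Filter ι} {σ : Matrix n n ℂ} (hσ : σ.PosSemidef)
    {p : ι → ℝ} (hp : Tendsto p l (𝓝 0)) (hp0 : ∀ᶠ i in l, p i ≠ 0) :
    Tendsto (fun i => opPow σ (p i)) l (𝓝 (1 - kerProj σ)) := by
  have h1 : 1 - kerProj σ = cfc (fun x : ℝ => 1 - if x = 0 then 1 else 0) σ := by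
    rw [kerProj, cfc_sub (a := σ) (hf := continuousOn_spectrum _ _)
      (hg := continuousOn_spectrum _ _), cfc_one_eq hσ.isHermitian]
  rw [h1]
  refine tendsto_cfc_of_eigenvalues hσ.isHermitian fun i => ?_
  by_cases hq : hσ.isHermitian.eigenvalues i = 0
  · simp only [hq, if_true, sub_self]
    refine tendsto_const_nhds.congr' ?_
    filter_upwards [hp0] with j hj
    rw [Real.zero_rpow hj]
  · simp only [hq, if_false, sub_zero]
    simpa [Function.comp_def] using (Real.continuousAt_const_rpow hq).tendsto.comp hp

lemma eventually_near_one : ∀ᶠ α : ℝ in 𝓝[≠] 1, α ≠ 1 ∧ 1 / 2 < α ∧ α < 2 := by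
  filter_upwards [self_mem_nhdsWithin,
    nhdsWithin_le_nhds (Ioo_mem_nhds (by norm_num : (1 / 2 : ℝ) < 1) one_lt_two)] with α h1 h2
  exact ⟨h1, h2.1, h2.2⟩

lemma tendsto_sandwich {ρ σ : Matrix n n ℂ} (hρ : ρ.PosSemidef) (hσ : σ.PosSemidef)
    (hs : supp ρ ≤ supp σ) : Tendsto (fun α => sandwich α ρ σ) (𝓝[≠] 1) (𝓝 ρ) := by
  have h1 : ρ * kerProj σ = 0 := (supp_le_iff_mul_kerProj hσ.isHermitian).1 hs
  have hPh : (kerProj σ)ᴴ = kerProj σ := isHermitian_cfc _ _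
  have h2 : kerProj σ * ρ = 0 := by
    have := congrArg conjTranspose h1
    rwa [conjTranspose_mul, hPh, hρ.isHermitian.eq, conjTranspose_zero] at this
  have hp : Tendsto (fun α : ℝ => (1 - α) / (2 * α)) (𝓝[≠] 1) (𝓝 0) := by
    have : ContinuousAt (fun α : ℝ => (1 - α) / (2 * α)) 1 := by fun_prop (disch := norm_num)
    simpa using this.tendsto.mono_left nhdsWithin_le_nhds
  have hp0 : ∀ᶠ α : ℝ in 𝓝[≠] 1, (1 - α) / (2 * α) ≠ 0 := by
    filter_upwards [eventually_near_one] with α hα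
    exact div_ne_zero (sub_ne_zero.2 hα.1.symm) (by linarith [hα.2.1])
  have h3 := tendsto_opPow_zero hσ hp hp0
  have h4 := (h3.mul_const ρ).mul h3
  have h5 : (1 - kerProj σ) * ρ * (1 - kerProj σ) = ρ := by
    rw [Matrix.sub_mul, h2, Matrix.one_mul, sub_zero, Matrix.mul_sub, h1, Matrix.mul_one, sub_zero]
  rwa [h5] at h4

lemma continuous_trace_re {m : Type*} [Fintype m] :
    Continuous fun A : Matrix m m ℂ => A.trace.re := by fun_prop

/-- The relative entropy `Tr[ρ (log ρ - g(σ))]` in natural units, with the logarithm of the second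
argument replaced by a function `g`. -/
def relEntropyNat (g : ℝ → ℝ) (ρ σ : Matrix n n ℂ) : ℝ :=
  (cfc (fun x : ℝ => x * Real.log x) ρ).trace.re - (ρ * cfc g σ).trace.re

lemma trace_eq_sum_overlap {ρ σ : Matrix n n ℂ} (hρ : ρ.IsHermitian) (hσ : σ.IsHermitian) :
    ρ.trace.re = ∑ i, ∑ j, overlap hρ hσ i j * hρ.eigenvalues i := by
  have := trace_cfc_mul_cfc hρ hσ (fun x => x) (fun _ => 1)
  simpa only [cfc_id_eq hρ, cfc_one_eq hσ, Matrix.mul_one, mul_one] using this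

lemma trace_mul_cfc {ρ σ : Matrix n n ℂ} (hρ : ρ.IsHermitian) (hσ : σ.IsHermitian) (g : ℝ → ℝ) :
    (ρ * cfc g σ).trace.re =
      ∑ i, ∑ j, overlap hρ hσ i j * (hρ.eigenvalues i * g (hσ.eigenvalues j)) := by
  have := trace_cfc_mul_cfc hρ hσ (fun x => x) g
  rwa [cfc_id_eq hρ] at this

lemma tendsto_rpow_exponent_quotient {q : ℝ} (hq : 0 < q) :
    Tendsto (fun α : ℝ => (q ^ ((1 - α) / α) - 1) / (α - 1)) (𝓝[≠] 1) (𝓝 (-Real.log q)) := by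
  have h1 : HasDerivAt (fun α : ℝ => (1 - α) / α) (-1) 1 := by
    have := ((hasDerivAt_id (1 : ℝ)).const_sub 1).div (hasDerivAt_id (1 : ℝ)) one_ne_zero
    simpa [Pi.div_def] using! this
  have h2 := h1.const_rpow hq
  have h3 := hasDerivAt_iff_tendsto_slope.1 h2
  simp only [sub_self, zero_div, Real.rpow_zero, mul_one] at h3
  refine (h3.congr fun α => ?_).trans (le_of_eq (by ring_nf))
  simp [slope_def_field]

/-- The trace is a weighted sum of `q ^ ((1 - α) / α)` with total weight `1`, and each power has
derivative `-log q` at `α = 1`. Eigenvalues `q = 0` carry no weight, by the support condition. -/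
lemma tendsto_trace_sandwich_quotient {ρ σ : Matrix n n ℂ} (hρ : IsState ρ) (hσ : σ.PosSemidef)
    (hs : supp ρ ≤ supp σ) :
    Tendsto (fun α => ((sandwich α ρ σ).trace.re - 1) / (α - 1)) (𝓝[≠] 1)
      (𝓝 (-(ρ * cfc Real.log σ).trace.re)) := by
  have hw := (supp_le_iff_overlap hρ.1 hσ.isHermitian).1 hs
  have hone : ∑ i, ∑ j, overlap hρ.1.isHermitian hσ.isHermitian i j *
      hρ.1.isHermitian.eigenvalues i = 1 := by
    rw [← trace_eq_sum_overlap, hρ.2, Complex.one_re]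
  have hev : (fun α => ∑ i, ∑ j, overlap hρ.1.isHermitian hσ.isHermitian i j *
      hρ.1.isHermitian.eigenvalues i *
        ((hσ.isHermitian.eigenvalues j ^ ((1 - α) / α) - 1) / (α - 1))) =ᶠ[𝓝[≠] (1 : ℝ)]
      (fun α => ((sandwich α ρ σ).trace.re - 1) / (α - 1)) := by
    filter_upwards [eventually_near_one] with α hα
    rw [trace_sandwich hσ (by linarith [hα.2.1]) hα.1, opPow,
      trace_mul_cfc hρ.1.isHermitian hσ.isHermitian]
    nth_rewrite 5 [← hone]
    rw [← Finset.sum_sub_distrib, Finset.sum_div]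
    refine Finset.sum_congr rfl fun i _ => ?_
    rw [← Finset.sum_sub_distrib, Finset.sum_div]
    refine Finset.sum_congr rfl fun j _ => ?_
    ring
  refine Tendsto.congr' hev ?_
  rw [trace_mul_cfc hρ.1.isHermitian hσ.isHermitian, ← Finset.sum_neg_distrib]
  refine tendsto_finsetSum _ fun i _ => ?_
  rw [← Finset.sum_neg_distrib]
  refine tendsto_finsetSum _ fun j _ => ?_
  rcases (hσ.eigenvalues_nonneg j).eq_or_lt with hq | hq
  · have h0 := hw i j hq.symm
    simp only [h0, zero_mul, ← mul_assoc, neg_zero]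
    exact tendsto_const_nhds
  · rw [← mul_assoc, ← mul_neg]
    exact (tendsto_rpow_exponent_quotient hq).const_mul _

/-- An upper estimate for the difference quotient of `α ↦ sandwichedQ α ρ σ` at `α = 1`. -/
lemma sandwichedQ_quotient_le {ρ : Matrix n n ℂ} (hρ : ρ.PosSemidef) (σ : Matrix n n ℂ) {α : ℝ}
    (h0 : 0 < α) (h2 : α ≤ 2) (h1 : α ≠ 1) :
    (sandwichedQ α ρ σ - 1) / (α - 1) ≤ ((sandwich α ρ σ).trace.re - 1) / (α - 1) +
      ((cfc (fun x : ℝ => x * Real.log x) (sandwich α ρ σ)).trace.re +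
        |α - 1| * (cfc logSqWeight (sandwich α ρ σ)).trace.re) := by
  have hX := posSemidef_sandwich α hρ σ
  have hid : (sandwich α ρ σ).trace.re = ∑ i, hX.isHermitian.eigenvalues i := by
    have := trace_cfc_re hX.isHermitian fun x => x
    rwa [cfc_id_eq hX.isHermitian] at this
  rw [← sub_le_iff_le_add', ← sub_div, sub_sub_sub_cancel_right, hid, sandwichedQ_eq,
    trace_cfc_re hX.isHermitian, trace_cfc_re hX.isHermitian, trace_cfc_re hX.isHermitian,
    ← Finset.sum_sub_distrib, Finset.sum_div, Finset.mul_sum, ← Finset.sum_add_distrib]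
  exact Finset.sum_le_sum fun i _ => rpow_sub_self_div_le (hX.eigenvalues_nonneg i) h0 h2 h1

lemma tendsto_cfc_of_tendsto {ι : Type*} {l : Filter ι} {f : ℝ → ℝ} (hf : Continuous f)
    {X : ι → Matrix n n ℂ} {A : Matrix n n ℂ} (hX : Tendsto X l (𝓝 A))
    (hXh : ∀ᶠ i in l, (X i).IsHermitian) (hA : A.IsHermitian) :
    Tendsto (fun i => cfc f (X i)) l (𝓝 (cfc f A)) :=
  (continuousOn_cfc_isHermitian hf A hA).tendsto.comp (tendsto_nhdsWithin_iff.2 ⟨hX, hXh⟩)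

lemma relEntropy_eq {ρ σ : Matrix n n ℂ} (hρ : ρ.IsHermitian) (hs : supp ρ ≤ supp σ) :
    relEntropy ρ σ = ((relEntropyNat Real.log ρ σ / Real.log 2 : ℝ) : EReal) := by
  have hlog : ∀ A : Matrix n n ℂ, opLog A = (1 / Real.log 2 : ℝ) • cfc Real.log A := by
    intro A
    rw [opLog, ← cfc_smul (hf := continuousOn_spectrum _ _)]
    congr 1; funext x
    rw [Real.logb, smul_eq_mul]; ring
  have h1 : ρ * cfc Real.log ρ = cfc (fun x : ℝ => x * Real.log x) ρ := by
    nth_rewrite 1 [← cfc_id_eq hρ]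
    rw [cfc_mul_eq]
  rw [relEntropy, if_pos hs, hlog, hlog, ← smul_sub, Matrix.mul_smul, Matrix.trace_smul,
    Matrix.mul_sub, Matrix.trace_sub, h1, relEntropyNat, Complex.real_smul, Complex.re_ofReal_mul,
    Complex.sub_re, one_div_mul_eq_div]

/-- Along `α → 1` the sandwiched Rényi relative entropies are eventually bounded by real numbers
that converge to the relative entropy. -/
lemma exists_tendsto_upper {ρ σ : Matrix n n ℂ} (hρ : IsState ρ) (hσ : σ.PosSemidef)
    (hs : supp ρ ≤ supp σ) :
    ∃ v : ℝ → ℝ, Tendsto v (𝓝[≠] 1) (𝓝 (relEntropyNat Real.log ρ σ / Real.log 2)) ∧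
      ∀ᶠ α in 𝓝[≠] 1, sandwichedRelEntropy α ρ σ ≤ (v α : EReal) := by
  set u : ℝ → ℝ := fun α => ((sandwich α ρ σ).trace.re - 1) / (α - 1) +
      ((cfc (fun x : ℝ => x * Real.log x) (sandwich α ρ σ)).trace.re +
        |α - 1| * (cfc logSqWeight (sandwich α ρ σ)).trace.re) with hu
  have ht : Tendsto (fun α : ℝ => α - 1) (𝓝[≠] 1) (𝓝 0) := by
    have : ContinuousAt (fun α : ℝ => α - 1) 1 := by fun_prop
    simpa using this.tendsto.mono_left nhdsWithin_le_nhds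
  have ht0 : ∀ᶠ α : ℝ in 𝓝[≠] 1, α - 1 ≠ 0 := by
    filter_upwards [self_mem_nhdsWithin] with α hα
    exact sub_ne_zero.2 hα
  have hX := tendsto_sandwich hρ.1 hσ hs
  have hXh : ∀ᶠ α : ℝ in 𝓝[≠] 1, (sandwich α ρ σ).IsHermitian :=
    Eventually.of_forall fun α => (posSemidef_sandwich α hρ.1 σ).isHermitian
  have htr := continuous_trace_re (m := n)
  have h1 := (htr.tendsto _).comp
    (tendsto_cfc_of_tendsto Real.continuous_mul_log hX hXh hρ.1.isHermitian)
  have h2 := (htr.tendsto _).comp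
    (tendsto_cfc_of_tendsto continuous_logSqWeight hX hXh hρ.1.isHermitian)
  have h3 : Tendsto u (𝓝[≠] 1) (𝓝 (relEntropyNat Real.log ρ σ)) := by
    have := (tendsto_trace_sandwich_quotient hρ hσ hs).add (h1.add (ht.abs.mul h2))
    refine this.trans (le_of_eq ?_)
    rw [relEntropyNat, abs_zero, zero_mul, add_zero, neg_add_eq_sub]
  refine ⟨fun α => Real.log (1 + (α - 1) * u α) / (α - 1) / Real.log 2,
    (tendsto_log_one_add_mul_div ht ht0 h3).div_const _, ?_⟩
  have hpos : ∀ᶠ α : ℝ in 𝓝[≠] 1, 0 < 1 + (α - 1) * u α := by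
    have : Tendsto (fun α => 1 + (α - 1) * u α) (𝓝[≠] 1) (𝓝 1) := by
      simpa using (ht.mul h3).const_add 1
    exact this.eventually (lt_mem_nhds one_pos)
  filter_upwards [hpos, eventually_near_one] with α hα hα1
  exact sandwichedRelEntropy_le hα1.1 hs
    (sandwichedQ_quotient_le hρ.1 σ (by linarith [hα1.2.1]) hα1.2.2.le hα1.1) hα

end PointwiseUpperBound

/-! ### Scalar tangent bounds and the truncated logarithm. -/

section ScalarLowerBound

/-- Bernoulli's inequality at `s = x / y - 1`, rescaled by `y ^ α`. -/
lemma rpow_le_tangent {x y α : ℝ} (hx : 0 ≤ x) (hy : 0 < y) (h0 : 0 ≤ α) (h1 : α ≤ 1) :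
    x ^ α ≤ (1 - α) * y ^ α + α * (x * y ^ (α - 1)) := by
  have hxy : 0 ≤ x / y := div_nonneg hx hy.le
  have h := rpow_one_add_le_one_add_mul_self (s := x / y - 1) (by linarith) h0 h1
  rw [add_sub_cancel, Real.div_rpow hx hy.le, div_le_iff₀ (Real.rpow_pos_of_pos hy α)] at h
  refine h.trans (le_of_eq ?_)
  rw [Real.rpow_sub_one hy.ne']
  field_simp
  ring

lemma tangent_le_rpow {x y α : ℝ} (hx : 0 ≤ x) (hy : 0 ≤ y) (h1 : 1 < α) :
    (1 - α) * y ^ α + α * (x * y ^ (α - 1)) ≤ x ^ α := by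
  rcases hy.eq_or_lt with rfl | hy
  · rw [Real.zero_rpow (by linarith), Real.zero_rpow (by linarith)]
    simpa using Real.rpow_nonneg hx α
  have hxy : 0 ≤ x / y := div_nonneg hx hy.le
  have h := one_add_mul_self_le_rpow_one_add (s := x / y - 1) (by linarith) h1.le
  rw [add_sub_cancel, Real.div_rpow hx hy.le, le_div_iff₀ (Real.rpow_pos_of_pos hy α)] at h
  refine le_trans (le_of_eq ?_) h
  rw [Real.rpow_sub_one hy.ne']
  field_simp
  ring

/-- The logarithm truncated from below at `log ε`. -/
def truncLog (ε x : ℝ) : ℝ := Real.log (max x ε)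

lemma continuous_truncLog {ε : ℝ} (hε : 0 < ε) : Continuous (truncLog ε) :=
  (continuous_id.max continuous_const).log fun _ => (hε.trans_le (le_max_right _ _)).ne'

lemma truncLog_nonpos {ε x : ℝ} (hε : 0 < ε) (hε1 : ε ≤ 1) (hx1 : x ≤ 1) : truncLog ε x ≤ 0 :=
  Real.log_nonpos (hε.le.trans (le_max_right _ _)) (max_le hx1 hε1)

/-- For `α < 1`, raising `q` to `max q ε` increases the power, and the second-order bound on `exp`
has error at most `(s log ε)²`. For `α > 1` the tangent bound on `exp` gives `-log q`, which exceeds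
its truncation; `q = 0` is excluded there because Lean's negative powers of `0` are `0`, not
infinite. -/
lemma neg_truncLog_sub_le {ε q α : ℝ} (hε : 0 < ε) (hε1 : ε ≤ 1) (hq : 0 ≤ q) (hq1 : q ≤ 1)
    (hα : 1 / 2 < α) (h1 : α ≠ 1) (hq0 : 1 < α → q ≠ 0) :
    -truncLog ε q - 2 * Real.log ε ^ 2 * |α - 1| ≤ α * ((q ^ ((1 - α) / α) - 1) / (α - 1)) := by
  have hα0 : 0 < α := by linarith
  have hm : 0 < max q ε := hε.trans_le (le_max_right _ _)
  rcases lt_or_gt_of_ne h1 with h | h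
  · set s := (1 - α) / α with hs
    have hs0 : 0 < s := div_pos (by linarith) hα0
    have hL0 : truncLog ε q ≤ 0 := truncLog_nonpos hε hε1 hq1
    have hLε : Real.log ε ≤ truncLog ε q := Real.log_le_log hε (le_max_right _ _)
    have hLsq : truncLog ε q ^ 2 ≤ Real.log ε ^ 2 := by nlinarith
    have h2 : q ^ s ≤ 1 + s * truncLog ε q + s ^ 2 * Real.log ε ^ 2 := by
      calc q ^ s ≤ (max q ε) ^ s := Real.rpow_le_rpow hq (le_max_left _ _) hs0.le
        _ = Real.exp (s * truncLog ε q) := by rw [Real.rpow_def_of_pos hm, mul_comm]; rfl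
        _ ≤ 1 + s * truncLog ε q + (s * truncLog ε q) ^ 2 :=
            exp_le_one_add_add_sq_of_nonpos (mul_nonpos_of_nonneg_of_nonpos hs0.le hL0)
        _ ≤ _ := by rw [mul_pow]; gcongr
    have h3 : α * ((q ^ s - 1) / (α - 1)) = -((q ^ s - 1) / s) := by
      rw [hs]
      have : α - 1 ≠ 0 := sub_ne_zero.2 h1
      have : 1 - α ≠ 0 := sub_ne_zero.2 h1.symm
      field_simp
      ring
    have h4 : (q ^ s - 1) / s ≤ truncLog ε q + s * Real.log ε ^ 2 := by
      rw [div_le_iff₀ hs0]; nlinarith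
    -- The constant `2` comes from `α > 1 / 2`.
    have h5 : s ≤ 2 * |α - 1| := by
      rw [abs_of_neg (by linarith), hs, div_le_iff₀ hα0]
      nlinarith
    have h6 : s * Real.log ε ^ 2 ≤ 2 * |α - 1| * Real.log ε ^ 2 := by gcongr
    rw [h3]
    linarith
  · have hqp : 0 < q := lt_of_le_of_ne hq (hq0 h).symm
    have hL : Real.log q ≤ truncLog ε q := Real.log_le_log hqp (le_max_left _ _)
    have ht : 0 < α - 1 := by linarith
    have h2 : 1 + (1 - α) / α * Real.log q ≤ q ^ ((1 - α) / α) := by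
      rw [Real.rpow_def_of_pos hqp, mul_comm]
      linarith [Real.add_one_le_exp (Real.log q * ((1 - α) / α))]
    have h3 : -Real.log q ≤ α * ((q ^ ((1 - α) / α) - 1) / (α - 1)) := by
      rw [← mul_div_assoc, le_div_iff₀ ht]
      calc -Real.log q * (α - 1) = α * ((1 - α) / α * Real.log q) := by field_simp; ring
        _ ≤ _ := by gcongr; linarith
    have h4 : 0 ≤ 2 * Real.log ε ^ 2 * |α - 1| := by positivity
    linarith

end ScalarLowerBound

/-! ### Lower bound that is continuous in `σ`. -/

section LowerBound

variable {n : Type*} [Fintype n] [DecidableEq n]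

lemma trace_cfc_eq_sum_overlap_left {A B : Matrix n n ℂ} (hA : A.IsHermitian)
    (hB : B.IsHermitian) (f : ℝ → ℝ) :
    (cfc f A).trace.re = ∑ i, ∑ j, overlap hA hB i j * f (hA.eigenvalues i) := by
  have := trace_cfc_mul_cfc hA hB f (fun _ => 1)
  simpa only [cfc_one_eq hB, Matrix.mul_one, mul_one] using this

lemma trace_cfc_eq_sum_overlap_right {A B : Matrix n n ℂ} (hA : A.IsHermitian)
    (hB : B.IsHermitian) (f : ℝ → ℝ) :
    (cfc f B).trace.re = ∑ i, ∑ j, overlap hA hB i j * f (hB.eigenvalues j) := by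
  have := trace_cfc_mul_cfc hA hB (fun _ => 1) f
  simpa only [cfc_one_eq hA, Matrix.one_mul, one_mul] using this

/-- The sandwiched operator with the roles of the factors exchanged: it has the same nonzero
spectrum as `sandwich α ρ σ`, and its support is contained in that of `ρ`. -/
def swappedSandwich (α : ℝ) (ρ σ : Matrix n n ℂ) : Matrix n n ℂ :=
  cfc Real.sqrt ρ * opPow σ ((1 - α) / α) * cfc Real.sqrt ρ

lemma swappedSandwich_eq {α : ℝ} (ρ : Matrix n n ℂ) {σ : Matrix n n ℂ} (hσ : σ.PosSemidef)
    (h0 : α ≠ 0) (h1 : α ≠ 1) :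
    swappedSandwich α ρ σ = (cfc Real.sqrt ρ * opPow σ ((1 - α) / (2 * α))) *
      (cfc Real.sqrt ρ * opPow σ ((1 - α) / (2 * α)))ᴴ := by
  have hS : (cfc Real.sqrt ρ)ᴴ = cfc Real.sqrt ρ := isHermitian_cfc _ _
  have hP : (opPow σ ((1 - α) / (2 * α)))ᴴ = opPow σ ((1 - α) / (2 * α)) := isHermitian_cfc _ _
  rw [conjTranspose_mul, hS, hP, swappedSandwich, ← opPow_mul_self hσ h0 h1]
  simp only [Matrix.mul_assoc]

/-- With `X = √ρ σ^((1-α)/(2α))`, the two operators are `Xᴴ X` and `X Xᴴ`. -/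
lemma sandwichedQ_eq_swapped {α : ℝ} {ρ σ : Matrix n n ℂ} (hρ : ρ.PosSemidef)
    (hσ : σ.PosSemidef) (h0 : α ≠ 0) (h1 : α ≠ 1) :
    sandwichedQ α ρ σ = (cfc (fun x : ℝ => x ^ α) (swappedSandwich α ρ σ)).trace.re := by
  have hS : (cfc Real.sqrt ρ)ᴴ = cfc Real.sqrt ρ := isHermitian_cfc _ _
  have hP : (opPow σ ((1 - α) / (2 * α)))ᴴ = opPow σ ((1 - α) / (2 * α)) := isHermitian_cfc _ _
  rw [swappedSandwich_eq ρ hσ h0 h1, ← trace_cfc_conjTranspose_mul_self, sandwichedQ_eq, sandwich,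
    conjTranspose_mul, hS, hP]
  nth_rewrite 1 [← cfc_sqrt_mul_self hρ]
  simp only [Matrix.mul_assoc]

lemma posSemidef_swappedSandwich {α : ℝ} (ρ : Matrix n n ℂ) {σ : Matrix n n ℂ}
    (hσ : σ.PosSemidef) (h0 : α ≠ 0) (h1 : α ≠ 1) : (swappedSandwich α ρ σ).PosSemidef := by
  rw [swappedSandwich_eq ρ hσ h0 h1]
  exact posSemidef_self_mul_conjTranspose _

lemma supp_swappedSandwich_le (α : ℝ) {ρ : Matrix n n ℂ} (hρ : ρ.PosSemidef) (σ : Matrix n n ℂ) :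
    supp (swappedSandwich α ρ σ) ≤ supp ρ := by
  rw [supp_le_iff_mul_kerProj hρ.isHermitian, swappedSandwich, Matrix.mul_assoc]
  have : cfc Real.sqrt ρ * kerProj ρ = 0 := by
    rw [kerProj, cfc_mul_eq]
    have : (fun x : ℝ => √x * if x = 0 then (1 : ℝ) else 0) = fun _ => 0 := by
      funext x; split_ifs with h <;> simp [h]
    rw [this, cfc_const_zero]
  rw [this, Matrix.mul_zero]

lemma trace_swappedSandwich_mul {α : ℝ} {ρ : Matrix n n ℂ} (hρ : ρ.PosSemidef) (σ : Matrix n n ℂ)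
    (h0 : α ≠ 0) :
    (swappedSandwich α ρ σ * opPow ρ (α - 1)).trace =
      (opPow ρ α * opPow σ ((1 - α) / α)).trace := by
  have h : cfc Real.sqrt ρ * opPow ρ (α - 1) * cfc Real.sqrt ρ = opPow ρ α := by
    rw [opPow, opPow, cfc_mul_eq, cfc_mul_eq]
    refine cfc_congr_of_posSemidef hρ fun x hx => ?_
    rw [mul_right_comm, Real.mul_self_sqrt hx, ← Real.rpow_one_add' hx (by simpa using h0)]
    simp
  rw [← h, swappedSandwich]
  calc _ = (cfc Real.sqrt ρ * (opPow σ ((1 - α) / α) *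
        (cfc Real.sqrt ρ * opPow ρ (α - 1)))).trace := by simp only [Matrix.mul_assoc]
    _ = (opPow σ ((1 - α) / α) * (cfc Real.sqrt ρ * opPow ρ (α - 1) * cfc Real.sqrt ρ)).trace := by
        rw [Matrix.trace_mul_comm]; simp only [Matrix.mul_assoc]
    _ = _ := Matrix.trace_mul_comm _ _

/-- The tangent bound for the trace function `x ↦ x ^ α` at `ρ`. -/
lemma tangent_quotient_le {α : ℝ} {ρ σ : Matrix n n ℂ} (hρ : ρ.PosSemidef)
    (hσ : σ.PosSemidef) (h0 : 0 < α) (h1 : α ≠ 1) :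
    α * (((opPow ρ α * opPow σ ((1 - α) / α)).trace.re - (opPow ρ α).trace.re) / (α - 1)) ≤
      (sandwichedQ α ρ σ - (opPow ρ α).trace.re) / (α - 1) := by
  have hX := posSemidef_swappedSandwich ρ hσ h0.ne' h1
  have hXh := hX.isHermitian
  have hρh := hρ.isHermitian
  have hsupp := (supp_le_iff_overlap hX hρh).1 (supp_swappedSandwich_le α hρ σ)
  have hM : (opPow ρ α * opPow σ ((1 - α) / α)).trace.re = ∑ i, ∑ j, overlap hXh hρh i j *
      (hXh.eigenvalues i * hρh.eigenvalues j ^ (α - 1)) := by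
    rw [← trace_swappedSandwich_mul hρ σ h0.ne', opPow]
    exact trace_mul_cfc hXh hρh _
  have hT : (opPow ρ α).trace.re = ∑ i, ∑ j, overlap hXh hρh i j * hρh.eigenvalues j ^ α :=
    trace_cfc_eq_sum_overlap_right hXh hρh _
  have hQ : sandwichedQ α ρ σ = ∑ i, ∑ j, overlap hXh hρh i j * hXh.eigenvalues i ^ α := by
    rw [sandwichedQ_eq_swapped hρ hσ h0.ne' h1]
    exact trace_cfc_eq_sum_overlap_left hXh hρh _
  have hB : (1 - α) * (opPow ρ α).trace.re +
      α * (opPow ρ α * opPow σ ((1 - α) / α)).trace.re = ∑ i, ∑ j, overlap hXh hρh i j *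
        ((1 - α) * hρh.eigenvalues j ^ α +
          α * (hXh.eigenvalues i * hρh.eigenvalues j ^ (α - 1))) := by
    rw [hM, hT]
    simp only [Finset.mul_sum, ← Finset.sum_add_distrib]
    refine Finset.sum_congr rfl fun i _ => Finset.sum_congr rfl fun j _ => ?_
    ring
  rw [← mul_div_assoc]
  rcases lt_or_gt_of_ne h1 with h | h
  · refine div_le_div_of_nonpos_of_le (by linarith) ?_
    suffices sandwichedQ α ρ σ ≤ (1 - α) * (opPow ρ α).trace.re +
      α * (opPow ρ α * opPow σ ((1 - α) / α)).trace.re by linarith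
    rw [hB, hQ]
    refine Finset.sum_le_sum fun i _ => Finset.sum_le_sum fun j _ => ?_
    -- At `y = 0` the tangent to a concave power is unavailable. The swapped operator is supported
    -- inside `ρ`, so these terms vanish; this is the reason for the swap.
    rcases (hρ.eigenvalues_nonneg j).eq_or_lt with hy | hy
    · have hz : overlap hXh hρh i j * hXh.eigenvalues i ^ α = 0 := by
        rcases mul_eq_zero.1 (hsupp i j hy.symm) with h | h
        · rw [h, zero_mul]
        · rw [h, Real.zero_rpow h0.ne', mul_zero]
      rw [hz, ← hy, Real.zero_rpow h0.ne', Real.zero_rpow (sub_ne_zero.2 h1)]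
      simp
    · exact mul_le_mul_of_nonneg_left (rpow_le_tangent (hX.eigenvalues_nonneg i) hy h0.le h.le)
        (overlap_nonneg _ _ _ _)
  · refine (div_le_div_iff_of_pos_right (by linarith)).2 ?_
    suffices (1 - α) * (opPow ρ α).trace.re +
      α * (opPow ρ α * opPow σ ((1 - α) / α)).trace.re ≤ sandwichedQ α ρ σ by linarith
    rw [hB, hQ]
    refine Finset.sum_le_sum fun i _ => Finset.sum_le_sum fun j _ => ?_
    exact mul_le_mul_of_nonneg_left
      (tangent_le_rpow (hX.eigenvalues_nonneg i) (hρ.eigenvalues_nonneg j) h)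
        (overlap_nonneg _ _ _ _)

lemma IsState.sum_eigenvalues {σ : Matrix n n ℂ} (hσ : IsState σ) :
    ∑ i, hσ.1.isHermitian.eigenvalues i = 1 := by
  have h := trace_cfc_re hσ.1.isHermitian fun x => x
  rw [cfc_id_eq hσ.1.isHermitian] at h
  rw [← h]
  simp [hσ.2]

lemma IsState.eigenvalues_le_one {σ : Matrix n n ℂ} (hσ : IsState σ) (j : n) :
    hσ.1.isHermitian.eigenvalues j ≤ 1 := by
  rw [← hσ.sum_eigenvalues]
  exact Finset.single_le_sum (fun i _ => hσ.1.eigenvalues_nonneg i) (Finset.mem_univ j)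

/-- A lower estimate for the difference quotient of `α ↦ sandwichedQ α ρ σ` at `α = 1` that is
continuous in `σ`. -/
def lowerQuotient (ε α : ℝ) (ρ σ : Matrix n n ℂ) : ℝ :=
  ((opPow ρ α).trace.re - 1) / (α - 1) - (opPow ρ α * cfc (truncLog ε) σ).trace.re -
    2 * Real.log ε ^ 2 * |α - 1| * (opPow ρ α).trace.re

lemma lowerQuotient_le {ε α : ℝ} {ρ σ : Matrix n n ℂ} (hρ : ρ.PosSemidef) (hσ : IsState σ)
    (hε : 0 < ε) (hε1 : ε ≤ 1) (hα : 1 / 2 < α) (h1 : α ≠ 1)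
    (hs : 1 < α → supp ρ ≤ supp σ) :
    lowerQuotient ε α ρ σ ≤ (sandwichedQ α ρ σ - 1) / (α - 1) := by
  have h0 : 0 < α := by linarith
  have hρh := hρ.isHermitian
  have hσh := hσ.1.isHermitian
  have key : -(opPow ρ α * cfc (truncLog ε) σ).trace.re -
      2 * Real.log ε ^ 2 * |α - 1| * (opPow ρ α).trace.re ≤
      α * (((opPow ρ α * opPow σ ((1 - α) / α)).trace.re - (opPow ρ α).trace.re) / (α - 1)) := by
    have hT : (opPow ρ α).trace.re = ∑ i, ∑ j, overlap hρh hσh i j * hρh.eigenvalues i ^ α :=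
      trace_cfc_eq_sum_overlap_left hρh hσh _
    rw [hT, opPow, opPow, trace_cfc_mul_cfc hρh hσh, trace_cfc_mul_cfc hρh hσh,
      ← Finset.sum_sub_distrib, Finset.mul_sum, ← Finset.sum_neg_distrib,
      ← Finset.sum_sub_distrib, Finset.sum_div, Finset.mul_sum]
    refine Finset.sum_le_sum fun i _ => ?_
    rw [← Finset.sum_sub_distrib, Finset.mul_sum, ← Finset.sum_neg_distrib,
      ← Finset.sum_sub_distrib, Finset.sum_div, Finset.mul_sum]
    refine Finset.sum_le_sum fun j _ => ?_
    set w := overlap hρh hσh i j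
    set p := hρh.eigenvalues i
    set q := hσh.eigenvalues j
    suffices w * p ^ α * (-truncLog ε q - 2 * Real.log ε ^ 2 * |α - 1|) ≤
        w * p ^ α * (α * ((q ^ ((1 - α) / α) - 1) / (α - 1))) by
      refine le_trans (le_of_eq ?_) (this.trans (le_of_eq ?_)) <;> ring
    by_cases hq : 1 < α ∧ q = 0
    · have hz : w * p ^ α = 0 := by
        rcases mul_eq_zero.1 ((supp_le_iff_overlap hρ hσh).1 (hs hq.1) i j hq.2) with h | h
        · simp only [w, h, zero_mul]
        · simp only [p, h, Real.zero_rpow h0.ne', mul_zero]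
      simp [hz]
    · refine mul_le_mul_of_nonneg_left ?_ (mul_nonneg (overlap_nonneg _ _ _ _)
        (Real.rpow_nonneg (hρ.eigenvalues_nonneg i) _))
      exact neg_truncLog_sub_le hε hε1 (hσ.1.eigenvalues_nonneg j) (hσ.eigenvalues_le_one j) hα h1
        fun h hq0 => hq ⟨h, hq0⟩
  have h2 := key.trans (tangent_quotient_le hρ hσ.1 h0 h1)
  have h3 : (sandwichedQ α ρ σ - 1) / (α - 1) = ((opPow ρ α).trace.re - 1) / (α - 1) +
      (sandwichedQ α ρ σ - (opPow ρ α).trace.re) / (α - 1) := by ring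
  rw [h3, lowerQuotient]
  linarith

lemma tendsto_opPow_one {ρ : Matrix n n ℂ} (hρ : ρ.IsHermitian) :
    Tendsto (fun α => opPow ρ α) (𝓝[≠] 1) (𝓝 ρ) := by
  have : Tendsto (fun α => opPow ρ α) (𝓝[≠] 1) (𝓝 (cfc (fun x : ℝ => x) ρ)) := by
    refine tendsto_cfc_of_eigenvalues hρ fun i => ?_
    have h := (Real.continuousAt_const_rpow' (a := hρ.eigenvalues i) one_ne_zero).tendsto
    rw [Real.rpow_one] at h
    exact h.mono_left nhdsWithin_le_nhds
  rwa [cfc_id_eq hρ] at this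

lemma tendsto_rpow_sub_self_div {p : ℝ} (hp : 0 ≤ p) :
    Tendsto (fun α : ℝ => (p ^ α - p) / (α - 1)) (𝓝[≠] 1) (𝓝 (p * Real.log p)) := by
  rcases hp.eq_or_lt with rfl | hp
  · rw [zero_mul]
    refine tendsto_const_nhds.congr' ?_
    filter_upwards [eventually_near_one] with α hα
    rw [Real.zero_rpow (by linarith [hα.2.1])]; simp
  · have h := hasDerivAt_iff_tendsto_slope.1 ((hasDerivAt_id (1 : ℝ)).const_rpow hp)
    refine (h.congr fun α => ?_).trans (le_of_eq ?_)
    · simp [slope_def_field]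
    · simp [mul_comm]

lemma tendsto_trace_opPow_quotient {ρ : Matrix n n ℂ} (hρ : IsState ρ) :
    Tendsto (fun α => ((opPow ρ α).trace.re - 1) / (α - 1)) (𝓝[≠] 1)
      (𝓝 (cfc (fun x : ℝ => x * Real.log x) ρ).trace.re) := by
  rw [trace_cfc_re hρ.1.isHermitian]
  have : (fun α => ((opPow ρ α).trace.re - 1) / (α - 1)) = fun α =>
      ∑ i, (hρ.1.isHermitian.eigenvalues i ^ α - hρ.1.isHermitian.eigenvalues i) / (α - 1) := by
    funext α
    rw [opPow, trace_cfc_re hρ.1.isHermitian, ← Finset.sum_div, Finset.sum_sub_distrib,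
      hρ.sum_eigenvalues]
  rw [this]
  exact tendsto_finsetSum _ fun i _ => tendsto_rpow_sub_self_div (hρ.1.eigenvalues_nonneg i)

/-- `σ` enters only through the continuous function `truncLog ε`, so it may vary together with `α`,
with no condition on supports. -/
lemma tendsto_lowerQuotient {ι : Type*} {l : Filter ι} {ρ σ₀ : Matrix n n ℂ} {α : ι → ℝ}
    {σ : ι → Matrix n n ℂ} (hρ : IsState ρ) (hα : Tendsto α l (𝓝[≠] 1))
    (hσ : Tendsto σ l (𝓝 σ₀)) (hσh : ∀ᶠ i in l, (σ i).IsHermitian) (hσ₀ : σ₀.IsHermitian)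
    {ε : ℝ} (hε : 0 < ε) :
    Tendsto (fun i => lowerQuotient ε (α i) ρ (σ i)) l
      (𝓝 (relEntropyNat (truncLog ε) ρ σ₀)) := by
  have htr := continuous_trace_re (m := n)
  have h1 := (tendsto_trace_opPow_quotient hρ).comp hα
  have hP := (tendsto_opPow_one hρ.1.isHermitian).comp hα
  have h2 := (htr.tendsto _).comp
    (hP.mul (tendsto_cfc_of_tendsto (continuous_truncLog hε) hσ hσh hσ₀))
  have h3 := (htr.tendsto _).comp hP
  have h4 : Tendsto (fun i => |α i - 1|) l (𝓝 0) := by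
    have := ((hα.mono_right nhdsWithin_le_nhds).sub_const 1).abs
    simpa using this
  have := (h1.sub h2).sub ((h4.const_mul (2 * Real.log ε ^ 2)).mul h3)
  simpa [relEntropyNat, lowerQuotient, Function.comp_def] using this

/-- Take `ε` below every positive eigenvalue of `σ`; zero eigenvalues have no weight. -/
lemma exists_relEntropyNat_truncLog_eq {ρ σ : Matrix n n ℂ} (hρ : ρ.PosSemidef)
    (hσ : σ.PosSemidef) (hs : supp ρ ≤ supp σ) :
    ∃ ε, 0 < ε ∧ ε ≤ 1 ∧ relEntropyNat (truncLog ε) ρ σ = relEntropyNat Real.log ρ σ := by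
  have hev : ∀ᶠ ε : ℝ in 𝓝[>] 0, ∀ j, 0 < hσ.isHermitian.eigenvalues j →
      ε ≤ hσ.isHermitian.eigenvalues j := by
    refine eventually_all.2 fun j => ?_
    by_cases hj : 0 < hσ.isHermitian.eigenvalues j
    · filter_upwards [nhdsWithin_le_nhds (Iio_mem_nhds hj)] with ε hε _ using le_of_lt hε
    · exact Eventually.of_forall fun ε h => absurd h hj
  obtain ⟨ε, hε, hε0, hε1⟩ := (hev.and ((eventually_mem_nhdsWithin (s := Set.Ioi (0 : ℝ))).and
    (nhdsWithin_le_nhds (Iic_mem_nhds (one_pos : (0 : ℝ) < 1))))).exists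
  refine ⟨ε, hε0, hε1, ?_⟩
  rw [relEntropyNat, relEntropyNat, trace_mul_cfc hρ.isHermitian hσ.isHermitian,
    trace_mul_cfc hρ.isHermitian hσ.isHermitian]
  congr 1
  refine Finset.sum_congr rfl fun i _ => Finset.sum_congr rfl fun j _ => ?_
  rw [← mul_assoc, ← mul_assoc]
  rcases (hσ.eigenvalues_nonneg j).eq_or_lt with hq | hq
  · rw [(supp_le_iff_overlap hρ hσ.isHermitian).1 hs i j hq.symm, zero_mul, zero_mul]
  · rw [truncLog, max_eq_left (hε j hq)]

lemma exists_lt_relEntropyNat_truncLog {ρ σ : Matrix n n ℂ} (hρ : ρ.PosSemidef)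
    (hσ : IsState σ) (hs : ¬ supp ρ ≤ supp σ) (C : ℝ) :
    ∃ ε, 0 < ε ∧ ε ≤ 1 ∧ C < relEntropyNat (truncLog ε) ρ σ := by
  rw [supp_le_iff_overlap hρ hσ.1.isHermitian] at hs
  push Not at hs
  obtain ⟨i, j, hj, hij⟩ := hs
  set c := overlap hρ.isHermitian hσ.1.isHermitian i j * hρ.isHermitian.eigenvalues i with hc
  have hc0 : 0 < c := lt_of_le_of_ne
    (mul_nonneg (overlap_nonneg _ _ _ _) (hρ.eigenvalues_nonneg i)) hij.symm
  set η := (cfc (fun x : ℝ => x * Real.log x) ρ).trace.re with hη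
  -- The pair `(i, j)` has weight `c > 0` and `σ`-eigenvalue `0`. With `ε = exp (-N)` it contributes
  -- `c * N ≥ C - η + 1` to the entropy, and all other contributions are nonnegative.
  set N := max 0 ((C - η + 1) / c)
  have hε1 : Real.exp (-N) ≤ 1 := Real.exp_le_one_iff.2 (neg_nonpos.2 (le_max_left _ _))
  have hε0 := Real.exp_pos (-N)
  refine ⟨Real.exp (-N), hε0, hε1, ?_⟩
  have hterm : ∀ i' j', overlap hρ.isHermitian hσ.1.isHermitian i' j' *
      (hρ.isHermitian.eigenvalues i' *
        truncLog (Real.exp (-N)) (hσ.1.isHermitian.eigenvalues j')) ≤ 0 := fun i' j' =>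
    mul_nonpos_of_nonneg_of_nonpos (overlap_nonneg _ _ _ _)
      (mul_nonpos_of_nonneg_of_nonpos (hρ.eigenvalues_nonneg i')
        (truncLog_nonpos hε0 hε1 (hσ.eigenvalues_le_one j')))
  have hbound : (ρ * cfc (truncLog (Real.exp (-N))) σ).trace.re ≤ c * -N := by
    rw [trace_mul_cfc hρ.isHermitian hσ.1.isHermitian]
    have e1 : ∀ {f : n → ℝ} (_ : ∀ i, f i ≤ 0) (i : n), ∑ i, f i ≤ f i := by
      intro f hf i
      rw [← Finset.add_sum_erase _ _ (Finset.mem_univ i)]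
      linarith [Finset.sum_nonpos fun k (_ : k ∈ Finset.univ.erase i) => hf k]
    refine (e1 (fun i' => Finset.sum_nonpos fun j' _ => hterm i' j') i).trans
      ((e1 (hterm i) j).trans (le_of_eq ?_))
    rw [hj, truncLog, max_eq_right hε0.le, Real.log_exp, hc, mul_assoc]
  have hN : C - η + 1 ≤ c * N := by
    rw [← div_le_iff₀' hc0]; exact le_max_right _ _
  rw [relEntropyNat, ← hη]
  linarith

/-- Any number below the relative entropy is also below its truncation at some level. -/
lemma exists_lt_truncLog_of_lt_relEntropy {ρ σ : Matrix n n ℂ} (hρ : ρ.PosSemidef)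
    (hσ : IsState σ) {c b : ℝ} (h : (b : EReal) < relEntropy ρ σ + (c : EReal)) :
    ∃ ε, 0 < ε ∧ ε ≤ 1 ∧ b < relEntropyNat (truncLog ε) ρ σ / Real.log 2 + c := by
  by_cases hs : supp ρ ≤ supp σ
  · obtain ⟨ε, h0, h1, he⟩ := exists_relEntropyNat_truncLog_eq hρ hσ.1 hs
    refine ⟨ε, h0, h1, ?_⟩
    rw [relEntropy_eq hρ.isHermitian hs, ← EReal.coe_add, EReal.coe_lt_coe_iff] at h
    rwa [he]
  · obtain ⟨ε, h0, h1, he⟩ := exists_lt_relEntropyNat_truncLog hρ hσ hs ((b - c) * Real.log 2)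
    refine ⟨ε, h0, h1, ?_⟩
    rw [← lt_div_iff₀ (Real.log_pos one_lt_two)] at he
    linarith

end LowerBound

/-! ### The trace norm and compactness of the set of states. -/

section TraceNorm

variable {n : Type*} [Fintype n] [DecidableEq n]

lemma continuous_traceNorm : Continuous fun A : Matrix n n ℂ => traceNorm A := by
  have h : Continuous fun A : Matrix n n ℂ => cfc Real.sqrt (Aᴴ * A) :=
    (continuousOn_cfc_isHermitian Real.continuous_sqrt).comp_continuous
      (by fun_prop) fun A => isHermitian_conjTranspose_mul_self A
  exact continuous_trace_re.comp h

lemma trace_le_traceNorm {A : Matrix n n ℂ} (hA : A.IsHermitian) : A.trace.re ≤ traceNorm A := by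
  have h1 : cfc Real.sqrt (Aᴴ * A) = cfc (fun x : ℝ => √(x * x)) A := by
    have h2 : Aᴴ * A = cfc (fun x : ℝ => x * x) A := by
      rw [hA.eq, ← cfc_mul_eq, cfc_id_eq hA]
    rw [h2]
    exact (cfc_comp' Real.sqrt (fun x : ℝ => x * x) A
      Real.continuous_sqrt.continuousOn (continuousOn_spectrum _ _) hA).symm
  rw [traceNorm, h1, trace_cfc_re hA]
  nth_rewrite 1 [← cfc_id_eq hA]
  rw [trace_cfc_re hA]
  refine Finset.sum_le_sum fun i _ => ?_
  rw [Real.sqrt_mul_self_eq_abs]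
  exact le_abs_self _

/-- States are the image of the Frobenius unit sphere under `B ↦ Bᴴ B`, with `√ω` as preimage of
`ω`. -/
lemma isCompact_setOf_isState : IsCompact {ω : Matrix n n ℂ | IsState ω} := by
  have hball : IsCompact (Set.pi Set.univ fun _ : n => Set.pi Set.univ fun _ : n =>
      Metric.closedBall (0 : ℂ) 1) :=
    isCompact_univ_pi fun _ => isCompact_univ_pi fun _ => isCompact_closedBall _ _
  have hsphere : IsCompact {B : Matrix n n ℂ | (Bᴴ * B).trace = 1} := by
    refine hball.of_isClosed_subset (isClosed_eq (by fun_prop) continuous_const) ?_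
    intro (B : Matrix n n ℂ) hB i _ j _
    replace hB : (Bᴴ * B).trace = 1 := hB
    rw [mem_closedBall_zero_iff]
    have h1 : ∑ j, ∑ i, ‖B i j‖ ^ 2 = 1 := by
      have h2 : (((∑ j, ∑ i, ‖B i j‖ ^ 2 : ℝ)) : ℂ) = 1 := by
        rw [← hB]
        simp only [Matrix.trace, Matrix.diag_apply, Matrix.mul_apply, Matrix.conjTranspose_apply]
        push_cast
        refine Finset.sum_congr rfl fun j _ => Finset.sum_congr rfl fun i _ => ?_
        rw [RCLike.star_def, mul_comm, Complex.mul_conj, Complex.normSq_eq_norm_sq]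
        push_cast; rfl
      exact_mod_cast h2
    have h3 : ‖B i j‖ ^ 2 ≤ 1 := by
      rw [← h1]
      exact (Finset.single_le_sum (f := fun i => ‖B i j‖ ^ 2) (fun _ _ => by positivity)
        (Finset.mem_univ i)).trans (Finset.single_le_sum (f := fun j => ∑ i, ‖B i j‖ ^ 2)
          (fun _ _ => by positivity) (Finset.mem_univ j))
    exact (sq_le_one_iff₀ (norm_nonneg _)).1 h3
  have himage : {ω : Matrix n n ℂ | IsState ω} =
      (fun B : Matrix n n ℂ => Bᴴ * B) '' {B | (Bᴴ * B).trace = 1} := by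
    ext ω
    constructor
    · intro hω
      have hS : (cfc Real.sqrt ω)ᴴ * cfc Real.sqrt ω = ω := by
        rw [(isHermitian_cfc Real.sqrt ω).eq, cfc_sqrt_mul_self hω.1]
      exact ⟨cfc Real.sqrt ω, by simpa only [Set.mem_ofPred_eq, hS] using hω.2, hS⟩
    · rintro ⟨B, hB, rfl⟩
      exact ⟨posSemidef_conjTranspose_mul_self B, hB⟩
  rw [himage]
  exact hsphere.image (by fun_prop)

end TraceNorm

/-! ### Decompositions over bipartitions and the two halves of the limit. -/

section Multipartite

variable {k : ℕ} {d : Fin k → ℕ}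

lemma isHermitian_partialTranspose (S : Finset (Fin k)) {X : Op d} (hX : X.IsHermitian) :
    (partialTranspose S X).IsHermitian := by
  ext a b
  simp only [partialTranspose, Matrix.conjTranspose_apply, Matrix.of_apply]
  exact hX.apply _ _

lemma trace_partialTranspose (S : Finset (Fin k)) (X : Op d) :
    (partialTranspose S X).trace = X.trace := by
  simp [partialTranspose, Matrix.trace]

lemma continuous_partialTranspose (S : Finset (Fin k)) :
    Continuous fun X : Op d => partialTranspose S X :=
  continuous_matrix fun _ _ => continuous_id.matrix_elem _ _

/-- The pairs of a probability distribution on the bipartitions and a family of states. -/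
def feasibleSet (d : Fin k → ℕ) : Set ((Bipartition k → ℝ) × (Bipartition k → Op d)) :=
  stdSimplex ℝ (Bipartition k) ×ˢ Set.pi Set.univ fun _ => {ω | IsState ω}

lemma isCompact_feasibleSet : IsCompact (feasibleSet d) :=
  (isCompact_stdSimplex ℝ _).prod (isCompact_univ_pi fun _ => isCompact_setOf_isState)

/-- The convex combination of a family of states. -/
def mixture (z : (Bipartition k → ℝ) × (Bipartition k → Op d)) : Op d :=
  ∑ m, (z.1 m : ℂ) • z.2 m

/-- The average trace norm of the partial transposes. -/
def meanNorm (z : (Bipartition k → ℝ) × (Bipartition k → Op d)) : ℝ :=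
  ∑ m, z.1 m * traceNorm (partialTranspose m.1 (z.2 m))

lemma continuous_mixture : Continuous (mixture (d := d)) := by
  unfold mixture; fun_prop

lemma continuous_meanNorm : Continuous (meanNorm (d := d)) := by
  refine continuous_finsetSum _ fun m _ => (by fun_prop : Continuous fun z :
    (Bipartition k → ℝ) × (Bipartition k → Op d) => z.1 m).mul ?_
  exact continuous_traceNorm.comp ((continuous_partialTranspose m.1).comp (by fun_prop))

lemma isState_mixture {z : (Bipartition k → ℝ) × (Bipartition k → Op d)}
    (hz : z ∈ feasibleSet d) : IsState (mixture z) := by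
  refine ⟨Matrix.posSemidef_sum _ fun m _ => (hz.2 m trivial).1.smul ?_, ?_⟩
  · exact_mod_cast hz.1.1 m
  · rw [mixture, Matrix.trace_sum]
    simp only [Matrix.trace_smul, (hz.2 _ trivial).2, smul_eq_mul, mul_one]
    exact_mod_cast hz.1.2

/-- Partial transposition preserves the trace, which the trace norm dominates. This keeps the
logarithm of the mean norm continuous. -/
lemma one_le_meanNorm {z : (Bipartition k → ℝ) × (Bipartition k → Op d)}
    (hz : z ∈ feasibleSet d) : 1 ≤ meanNorm z := by
  rw [← hz.1.2, meanNorm]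
  refine Finset.sum_le_sum fun m _ => le_mul_of_one_le_right (hz.1.1 m) ?_
  have h := trace_le_traceNorm (isHermitian_partialTranspose m.1 (hz.2 m trivial).1.isHermitian)
  rwa [trace_partialTranspose, (hz.2 m trivial).2, Complex.one_re] at h

lemma rainsEntanglement_eq (D : Op d → Op d → EReal) (ρ : Op d) :
    rainsEntanglement D ρ = sInf ((fun z => D ρ (mixture z) +
      ((Real.logb 2 (meanNorm z) : ℝ) : EReal)) '' feasibleSet d) := by
  rw [rainsEntanglement]
  congr 1
  ext x
  constructor
  · rintro ⟨σ, r, ω, -, hr, hr1, hω, rfl, rfl⟩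
    exact ⟨(r, ω), ⟨⟨hr, hr1⟩, fun m _ => hω m⟩, rfl⟩
  · rintro ⟨z, hz, rfl⟩
    exact ⟨mixture z, z.1, z.2, isState_mixture hz, hz.1.1, hz.1.2, fun m => hz.2 m trivial,
      rfl, rfl⟩

lemma eventually_sandwichedRains_lt {ρ : Op d} (hρ : IsState ρ) {b : EReal} (hb : gmre ρ < b) :
    ∀ᶠ α in 𝓝[≠] 1, sandwichedRains α ρ < b := by
  rw [gmre, rainsEntanglement_eq, sInf_lt_iff] at hb
  obtain ⟨_, ⟨z, hz, rfl⟩, hlt⟩ := hb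
  have hσ := isState_mixture hz
  -- Otherwise the objective is `⊤`, which is not below `b`.
  have hs : supp ρ ≤ supp (mixture z) := by
    by_contra hs
    simp [relEntropy, if_neg hs] at hlt
  obtain ⟨v, hv, hle⟩ := exists_tendsto_upper hρ hσ.1 hs
  simp only [relEntropy_eq hρ.1.isHermitian hs, ← EReal.coe_add] at hlt
  have hlim : Tendsto (fun α => ((v α + Real.logb 2 (meanNorm z) : ℝ) : EReal)) (𝓝[≠] 1)
      (𝓝 ((relEntropyNat Real.log ρ (mixture z) / Real.log 2 +
        Real.logb 2 (meanNorm z) : ℝ) : EReal)) :=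
    (continuous_coe_real_ereal.tendsto _).comp (hv.add_const _)
  filter_upwards [hle, hlim.eventually (gt_mem_nhds hlt)] with α h1 h2
  rw [sandwichedRains, rainsEntanglement_eq]
  refine lt_of_le_of_lt (sInf_le ⟨z, hz, rfl⟩) (lt_of_le_of_lt ?_ h2)
  rw [EReal.coe_add]
  exact add_le_add_left h1 _

lemma eventually_lt_objective {ρ : Op d} (hρ : IsState ρ) {b : ℝ} (hb : (b : EReal) < gmre ρ)
    (z : feasibleSet d) :
    ∀ᶠ p : ℝ × feasibleSet d in 𝓝[≠] 1 ×ˢ 𝓝 z,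
      (b : EReal) < sandwichedRelEntropy p.1 ρ (mixture p.2.1) +
        ((Real.logb 2 (meanNorm p.2.1) : ℝ) : EReal) := by
  have hlt : (b : EReal) < relEntropy ρ (mixture z.1) +
      ((Real.logb 2 (meanNorm z.1) : ℝ) : EReal) := by
    rw [gmre, rainsEntanglement_eq] at hb
    exact hb.trans_le (sInf_le ⟨z.1, z.2, rfl⟩)
  obtain ⟨ε, hε0, hε1, hε⟩ :=
    exists_lt_truncLog_of_lt_relEntropy hρ.1 (isState_mixture z.2) hlt
  have hα : Tendsto (fun p : ℝ × feasibleSet d => p.1) (𝓝[≠] 1 ×ˢ 𝓝 z) (𝓝[≠] 1) := tendsto_fst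
  have hz : Tendsto (fun p : ℝ × feasibleSet d => (p.2 : _ × _)) (𝓝[≠] 1 ×ˢ 𝓝 z) (𝓝 z.1) :=
    (continuous_subtype_val.tendsto z).comp tendsto_snd
  have hu := tendsto_lowerQuotient hρ hα ((continuous_mixture.tendsto _).comp hz)
    (Eventually.of_forall fun p => (isState_mixture p.2.2).1.isHermitian)
    (isState_mixture z.2).1.isHermitian hε0
  have ht : Tendsto (fun p : ℝ × feasibleSet d => p.1 - 1) (𝓝[≠] 1 ×ˢ 𝓝 z) (𝓝 0) := by
    simpa using (hα.mono_right nhdsWithin_le_nhds).sub_const 1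
  have hnear := hα.eventually eventually_near_one
  have hlog : Tendsto (fun p : ℝ × feasibleSet d => Real.logb 2 (meanNorm p.2.1))
      (𝓝[≠] 1 ×ˢ 𝓝 z) (𝓝 (Real.logb 2 (meanNorm z.1))) :=
    Tendsto.logb ((continuous_meanNorm.tendsto _).comp hz)
      (by linarith [one_le_meanNorm z.2])
  have hlim := ((tendsto_log_one_add_mul_div ht
    (hnear.mono fun p hp => sub_ne_zero.2 hp.1) hu).div_const (Real.log 2)).add hlog
  have hpos := ((ht.mul hu).const_add 1).eventually
    (lt_mem_nhds (show (0 : ℝ) < _ by rw [zero_mul, add_zero]; exact one_pos))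
  filter_upwards [hlim.eventually (lt_mem_nhds hε), hpos, hnear] with p h1 h2 h3
  refine lt_of_lt_of_le (EReal.coe_lt_coe_iff.2 h1) ?_
  rw [EReal.coe_add]
  exact add_le_add_left (le_sandwichedRelEntropy h3.1 (fun hs => lowerQuotient_le hρ.1
    (isState_mixture p.2.2) hε0 hε1 h3.2.1 h3.1 hs) h2) _

lemma eventually_lt_sandwichedRains {ρ : Op d} (hρ : IsState ρ) {a : EReal} (ha : a < gmre ρ) :
    ∀ᶠ α in 𝓝[≠] 1, a < sandwichedRains α ρ := by
  -- The infimum turns strict bounds into `b ≤ _`; a real `b` strictly above `a` restores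
  -- strictness.
  obtain ⟨b, hab, hb⟩ := EReal.lt_iff_exists_real_btwn.1 ha
  have : CompactSpace (feasibleSet d) := isCompact_iff_compactSpace.1 isCompact_feasibleSet
  -- Tube lemma: the neighbourhoods in `(α, z)` yield one punctured neighbourhood of `1` valid for
  -- all decompositions.
  have h := (isCompact_univ (X := feasibleSet d)).mem_prod_nhdsSet_of_forall
    (l := 𝓝[≠] (1 : ℝ)) fun z _ => eventually_lt_objective hρ hb z
  rw [nhdsSet_univ] at h
  filter_upwards [Eventually.curry h] with α hα
  rw [eventually_top] at hα
  refine hab.trans_le ?_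
  rw [sandwichedRains, rainsEntanglement_eq]
  refine le_sInf ?_
  rintro _ ⟨z, hz, rfl⟩
  exact (hα ⟨z, hz⟩).le

end Multipartite

end MultipartiteRains

end

theorem mainTheorem9 (k : ℕ) (hk : 2 ≤ k) (d : Fin k → ℕ)
    (ρ : MultipartiteRains.Op d) (hρ : MultipartiteRains.IsState ρ) :
    Filter.Tendsto (fun α : ℝ => MultipartiteRains.sandwichedRains α ρ)
      (nhdsWithin 1 {1}ᶜ) (nhds (MultipartiteRains.gmre ρ)) :=
  tendsto_order.2 ⟨fun _ ha => MultipartiteRains.eventually_lt_sandwichedRains hρ ha,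
    fun _ hb => MultipartiteRains.eventually_sandwichedRains_lt hρ hb⟩
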